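/- Let $n,p\ge 2$ be integers. For $m\ge 2$ let $\mathbb{T}(\mathbb{C}^n,m)$ be the space of $m$-th order $n$-dimensional complex tensors $\mathcal{T}=(t_{i_1\ldots i_m})$, $1\le i_1,\dots,i_m\le n$, and let $\mathcal{T}\mathbf{x}^{m-1}$ be the vector of homogeneous polynomials of degree $m-1$ with $i$-th component $\sum_{i_2,\ldots,i_m=1}^n t_{ii_2\ldots i_m}x_{i_2}\cdots x_{i_m}$. The E-determinant $\mathrm{Edet}(\mathcal{T})$ is the resultant of the system $\mathcal{T}\mathbf{x}^{m-1}=\mathbf{0}$. Here the resultant of systems $h=(h_1,\dots,h_n)$ of forms of degrees $r_1,\dots,r_n\ge 1$ in $x_1,\dots,x_n$ over $\mathbb{C}$ is the irreducible polynomial $\mathrm{Res}$ in the coefficients of $h$ such that $\mathrm{Res}(h)=0$ if and only if $h=\mathbf{0}$ has a solution in $\mathbb{C}^n\setminus\{\mathbf{0}\}$, normalized by $\mathrm{Res}(x_1^{r_1},\dots,x_n^{r_n})=1$. For $\mathcal{U}\in\mathbb{T}(\mathbb{C}^n,p)$ and $\mathcal{V}\in\mathbb{T}(\mathbb{C}^n,q)$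 with $q\ge 2$, the composition $\mathcal{U}\circ\mathcal{V}\in\mathbb{T}(\mathbb{C}^n,(p-1)(q-1)+1)$ is the tensor with entries $$(\mathcal{U}\circ\mathcal{V})_{i\,J_2\ldots J_p}=\sum_{i_2,\ldots,i_p=1}^n u_{ii_2\ldots i_p}\,v_{i_2J_2}\cdots v_{i_pJ_p},$$ where $J_2,\dots,J_p$ range over $(q-1)$-tuples of indices in $\{1,\dots,n\}$. Then there is exactly one such normalized resultant polynomial for systems of $n$ forms of degree $p-1$ in $n$ variables (so $\mathrm{Edet}$ is well defined on $\mathbb{T}(\mathbb{C}^n,p)$), and for all $\mathcal{U}\in\mathbb{T}(\mathbb{C}^n,p)$ and every matrix $G\in\mathbb{T}(\mathbb{C}^n,2)$, $$\mathrm{Edet}(\mathcal{U}\circ G)=\mathrm{Edet}(\mathcal{U})\,\bigl(\mathrm{Det}(G)\bigr)^{(p-1)^n}.$$ That is, the composition formula $\mathrm{Edet}(\mathcal{U}\circ\mathcal{V})=\mathrm{Edet}(\mathcal{U})^{(q-1)^{n-1}}\,\mathrm{Edet}(\mathcal{V})^{(p-1)^n}$ holds when $q=2$. -/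

import Mathlib

open MvPolynomial

noncomputable section

/-- Complex tensors of order `m` and dimension `n` (used for `m ≥ 1`): `T i j` is the entry
`t_{i i₂ … i_m}`, with first index `i` and with `j = (i₂, …, i_m)`. -/
abbrev Tensor (n m : ℕ) : Type := Fin n → (Fin (m - 1) → Fin n) → ℂ

/-- The `i`-th component of `T x^{m-1}`, the homogeneous polynomial
`∑_{i₂, …, i_m} t_{i i₂ … i_m} x_{i₂} ⋯ x_{i_m}` of degree `m - 1`. -/
def Tensor.form {n m : ℕ} (T : Tensor n m) (i : Fin n) : MvPolynomial (Fin n) ℂ :=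
  ∑ j : Fin (m - 1) → Fin n, C (T i j) * ∏ k, X (j k)

/-- The matrix `(g_{i i₂})` of a tensor of order two. -/
def Tensor.toMatrix {n : ℕ} (G : Tensor n 2) : Matrix (Fin n) (Fin n) ℂ :=
  Matrix.of fun i j => G i fun _ => j

/-- The composition `U ∘ V`, a tensor of order `(p - 1)(q - 1) + 1`. Its indices after the first
one form `p - 1` consecutive blocks of length `q - 1`; the `k`-th block is an index tuple of `V`:
`w_{i j} = ∑_{i₂, …, i_p} u_{i i₂ … i_p} v_{i₂ (block 1 of j)} ⋯ v_{i_p (block p - 1 of j)}`. -/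
def Tensor.comp {n p q : ℕ} (U : Tensor n p) (V : Tensor n q) :
    Tensor n ((p - 1) * (q - 1) + 1) :=
  fun i (j : Fin ((p - 1) * (q - 1)) → Fin n) =>
    ∑ s : Fin (p - 1) → Fin n,
      U i s * ∏ k : Fin (p - 1), V (s k) fun l : Fin (q - 1) => j (finProdFinEquiv (k, l))

/-- Labels of the coefficients of a system of `n` forms in `n` variables of degrees
`r 0, …, r (n - 1)`: the number of the form, and a monomial of its degree. -/
abbrev CoeffIndex {n : ℕ} (r : Fin n → ℕ) : Type :=
  Σ i : Fin n, {α : Fin n →₀ ℕ // α.degree = r i}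

/-- The coefficients of a system of polynomials at the monomials of degree `r i`. -/
def systemCoeff {n : ℕ} (r : Fin n → ℕ) (h : Fin n → MvPolynomial (Fin n) ℂ) :
    CoeffIndex r → ℂ :=
  fun c => (h c.1).coeff c.2.1

/-- `R` is the resultant of systems of `n` forms in `n` variables of degrees `r i`: an irreducible
polynomial in the coefficients of the system which vanishes exactly at the systems with a
nontrivial common zero, with the constant factor fixed by `R(x₁^{r₁}, …, x_n^{r_n}) = 1`. -/
structure IsResultant {n : ℕ} (r : Fin n → ℕ) (R : MvPolynomial (CoeffIndex r) ℂ) : Prop where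
  irreducible : Irreducible R
  eval_eq_zero_iff : ∀ h : Fin n → MvPolynomial (Fin n) ℂ, (∀ i, (h i).IsHomogeneous (r i)) →
    (eval (systemCoeff r h) R = 0 ↔ ∃ x : Fin n → ℂ, x ≠ 0 ∧ ∀ i, eval x (h i) = 0)
  eval_X_pow : eval (systemCoeff r fun i => X i ^ r i) R = 1

open Classical in
/-- The resultant as a polynomial in the coefficients (`0` if there were none). -/
def resultantPoly {n : ℕ} (r : Fin n → ℕ) : MvPolynomial (CoeffIndex r) ℂ :=
  if h : ∃ R, IsResultant r R then h.choose else 0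

/-- The resultant `Res_r(h)` of a system `h` of `n` forms of degrees `r i` in `n` variables. -/
def resultant {n : ℕ} (r : Fin n → ℕ) (h : Fin n → MvPolynomial (Fin n) ℂ) : ℂ :=
  eval (systemCoeff r h) (resultantPoly r)

/-- The E-determinant of `T`: the resultant of the system `T x^{m-1} = 0`. -/
def Edet {n m : ℕ} (T : Tensor n m) : ℂ :=
  resultant (fun _ => m - 1) T.form

end

noncomputable section

/-! Fix positive degrees `r i`. The polynomials in the coefficients that vanish at every system with
a nontrivial zero form a prime ideal: it is the kernel of `forceZero`, which parametrizes the
systems having a given generic point as a zero. The ideal is nonzero, since a determinant of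
Macaulay type lies in it and is nonzero at a given unsolvable system. By Krull's height theorem any
`n - 1` of the forms share a nontrivial zero, and one coefficient of the remaining form can then be
adjusted to make it vanish there too; so the ideal contains no nonzero polynomial free of that
coefficient. By Gauss's lemma it is principal, and its generator, normalized, is the resultant.
Uniqueness holds because irreducible polynomials with the same zeros are proportional, by the
Nullstellensatz.

An invertible substitution `x ↦ G x` acts invertibly on coefficients and preserves solvability, so
by the same proportionality it multiplies the resultant by a constant. This constant is found on
generators of the invertible matrices. For transvections it is a polynomial in the parameter without
roots, hence 1. For diagonal matrices it follows from the degree of the resultant in the `i`-th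
form, `∏_{j ≠ i} r j`, which is bounded above by a Macaulay determinant and below by a pencil with
that many solvable members (`IsResultant.eval_scale`). If `det G = 0`, a kernel vector of `G` is a
common zero and both sides vanish. Composition with a matrix is exactly this substitution, and `Edet
G = det G` is the case of the identity tensor. -/

instance finite_degree_eq (n m : ℕ) : Finite {α : Fin n →₀ ℕ // α.degree = m} := by
  refine Set.Finite.to_subtype (s := {α : Fin n →₀ ℕ | α.degree = m}) ?_
  refine (Finset.finite_toSet (Finset.finsuppAntidiag Finset.univ m)).subset fun α hα => ?_
  simpa [Finset.mem_finsuppAntidiag, Finsupp.degree_eq_sum] using hα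

instance fintypeDegreeEq (n m : ℕ) : Fintype {α : Fin n →₀ ℕ // α.degree = m} :=
  Fintype.ofFinite _

/-! ### Systems as points of coefficient space, linear substitutions, curves of systems -/

section System

variable {n : ℕ} {r : Fin n → ℕ} {A B : Type*} [CommRing A] [CommRing B]

/-- The system of forms with prescribed coefficients. -/
def ofCoeff (a : CoeffIndex r → A) (i : Fin n) : MvPolynomial (Fin n) A :=
  ∑ α : {α : Fin n →₀ ℕ // α.degree = r i}, monomial α.1 (a ⟨i, α⟩)

theorem ofCoeff_isHomogeneous (a : CoeffIndex r → A) (i : Fin n) :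
    (ofCoeff a i).IsHomogeneous (r i) :=
  IsHomogeneous.sum _ _ _ fun α _ => isHomogeneous_monomial _ α.2

theorem coeff_ofCoeff (a : CoeffIndex r → A) (c : CoeffIndex r) :
    (ofCoeff a c.1).coeff c.2.1 = a c := by
  classical
  obtain ⟨i, α⟩ := c
  simp only [ofCoeff, coeff_sum, coeff_monomial]
  rw [Finset.sum_eq_single α]
  · simp
  · intro β _ hβ
    rw [if_neg fun h => hβ (Subtype.ext h)]
  · simp

theorem eq_ofCoeff_of_isHomogeneous {h : Fin n → MvPolynomial (Fin n) A}
    (hh : ∀ i, (h i).IsHomogeneous (r i)) :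
    ofCoeff (fun c : CoeffIndex r => (h c.1).coeff c.2.1) = h := by
  funext i
  ext α
  by_cases hα : α.degree = r i
  · exact coeff_ofCoeff (r := r) (fun c => (h c.1).coeff c.2.1) ⟨i, α, hα⟩
  · rw [(ofCoeff_isHomogeneous _ i).coeff_eq_zero hα, (hh i).coeff_eq_zero hα]

theorem systemCoeff_ofCoeff (a : CoeffIndex r → ℂ) : systemCoeff r (ofCoeff a) = a :=
  funext fun c => coeff_ofCoeff a c

theorem ofCoeff_systemCoeff {h : Fin n → MvPolynomial (Fin n) ℂ}
    (hh : ∀ i, (h i).IsHomogeneous (r i)) : ofCoeff (systemCoeff r h) = h :=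
  eq_ofCoeff_of_isHomogeneous hh

theorem map_ofCoeff (f : A →+* B) (a : CoeffIndex r → A) (i : Fin n) :
    map f (ofCoeff a i) = ofCoeff (fun c => f (a c)) i := by
  simp [ofCoeff, map_sum, map_monomial]

/-- The system with indeterminate coefficients. -/
def genericSystem (r : Fin n → ℕ) (i : Fin n) :
    MvPolynomial (Fin n) (MvPolynomial (CoeffIndex r) ℂ) :=
  ofCoeff X i

theorem map_genericSystem (a : CoeffIndex r → ℂ) (i : Fin n) :
    map (eval a) (genericSystem r i) = ofCoeff a i := by
  simp [genericSystem, map_ofCoeff]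

/-- The substitution `p(x) ↦ p(G x)`. -/
def linSubst (G : Matrix (Fin n) (Fin n) A) : MvPolynomial (Fin n) A →ₐ[A] MvPolynomial (Fin n) A :=
  aeval fun j => ∑ k, C (G j k) * X k

theorem eval_linSubst (G : Matrix (Fin n) (Fin n) A) (p : MvPolynomial (Fin n) A) (x : Fin n → A) :
    eval x (linSubst G p) = eval (G.mulVec x) p := by
  induction p using MvPolynomial.induction_on with
  | C a => simp [linSubst]
  | add p q hp hq => simp only [map_add, hp, hq]
  | mul_X p i hp => simp only [map_mul, hp]; simp [linSubst, Matrix.mulVec, dotProduct]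

theorem linSubst_linSubst (G H : Matrix (Fin n) (Fin n) A) (p : MvPolynomial (Fin n) A) :
    linSubst H (linSubst G p) = linSubst (G * H) p := by
  rw [← AlgHom.comp_apply]
  congr 1
  ext1 j
  simp only [AlgHom.comp_apply, linSubst, aeval_X, map_sum, map_mul, algHom_C, algebraMap_eq,
    Matrix.mul_apply, Finset.mul_sum, Finset.sum_mul]
  rw [Finset.sum_comm]
  simp [mul_assoc]

theorem linSubst_one (p : MvPolynomial (Fin n) A) : linSubst 1 p = p := by
  have : linSubst (1 : Matrix (Fin n) (Fin n) A) = AlgHom.id A _ := by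
    ext1 j
    simp [linSubst, Matrix.one_apply, apply_ite C, ite_mul]
  simp [this]

theorem linSubst_isHomogeneous (G : Matrix (Fin n) (Fin n) A) {p : MvPolynomial (Fin n) A} {m : ℕ}
    (hp : p.IsHomogeneous m) : (linSubst G p).IsHomogeneous m := by
  have := hp.aeval (fun j => ∑ k, C (G j k) * X k) (n := 1) fun j =>
    IsHomogeneous.sum _ _ _ fun k _ => by
      simpa using (isHomogeneous_C (Fin n) (G j k)).mul (isHomogeneous_X A k)
  simpa [linSubst] using this

theorem map_linSubst (f : A →+* B) (G : Matrix (Fin n) (Fin n) A) (p : MvPolynomial (Fin n) A) :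
    map f (linSubst G p) = linSubst (G.map f) (map f p) := by
  induction p using MvPolynomial.induction_on with
  | C a => simp [linSubst]
  | add p q hp hq => simp only [map_add, hp, hq]
  | mul_X p i hp => simp only [map_mul, hp]; simp [linSubst]

/-- A nontrivial common zero exists. -/
def HasZero (h : Fin n → MvPolynomial (Fin n) ℂ) : Prop :=
  ∃ x : Fin n → ℂ, x ≠ 0 ∧ ∀ i, eval x (h i) = 0

theorem HasZero.of_linSubst {G : Matrix (Fin n) (Fin n) ℂ} (hG : G.det ≠ 0)
    {h : Fin n → MvPolynomial (Fin n) ℂ} (hz : HasZero fun i => linSubst G (h i)) : HasZero h := by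
  obtain ⟨x, hx, hz⟩ := hz
  refine ⟨G.mulVec x, fun h0 => hx (Matrix.eq_zero_of_mulVec_eq_zero hG h0), fun i => ?_⟩
  rw [← eval_linSubst, hz]

theorem HasZero.linSubst {G : Matrix (Fin n) (Fin n) ℂ} (hG : G.det ≠ 0)
    {h : Fin n → MvPolynomial (Fin n) ℂ} (hz : HasZero h) :
    HasZero fun i => linSubst G (h i) := by
  refine HasZero.of_linSubst (G := G⁻¹) (by simpa [Matrix.det_nonsing_inv] using hG) ?_
  simpa [linSubst_linSubst, Matrix.mul_nonsing_inv _ (isUnit_iff_ne_zero.mpr hG), linSubst_one]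
    using hz

/-- The values of a polynomial in the coefficients along a polynomial curve of systems. -/
def curvePoly (R : MvPolynomial (CoeffIndex r) ℂ)
    (h : Fin n → MvPolynomial (Fin n) (Polynomial ℂ)) : Polynomial ℂ :=
  aeval (fun c : CoeffIndex r => (h c.1).coeff c.2.1) R

theorem eval_curvePoly (R : MvPolynomial (CoeffIndex r) ℂ)
    (h : Fin n → MvPolynomial (Fin n) (Polynomial ℂ)) (t : ℂ) :
    (curvePoly R h).eval t =
      eval (systemCoeff r fun i => map (Polynomial.evalRingHom t) (h i)) R := by
  have : (Polynomial.evalRingHom t) (curvePoly R h) = _ :=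
    map_aeval _ (Polynomial.evalRingHom t) R
  rw [Polynomial.coe_evalRingHom] at this
  rw [this]
  refine RingHom.congr_fun (MvPolynomial.ringHom_ext (fun a => ?_) fun c => ?_) R
  · simp
  · simp [systemCoeff, coeff_map]

end System

/-! ### Irreducible polynomials are determined by their zeros -/

section Associated

variable {σ : Type*}

/-- By the Nullstellensatz the prime ideal `(R)` is the vanishing ideal of its zero locus. -/
theorem dvd_of_forall_eval_eq_zero [Finite σ] {R S : MvPolynomial σ ℂ} (hR : Irreducible R)
    (h : ∀ a, eval a R = 0 → eval a S = 0) : R ∣ S := by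
  have hp : (Ideal.span {R}).IsPrime := (Ideal.span_singleton_prime hR.ne_zero).2 hR.prime
  rw [← Ideal.mem_span_singleton, ← IsPrime.vanishingIdeal_zeroLocus (K := ℂ) (Ideal.span {R})]
  intro a ha
  rw [zeroLocus_span] at ha
  simpa [aeval_eq_eval] using h a (by simpa [aeval_eq_eval] using ha)

theorem exists_C_mul_of_forall_eval_eq_zero_iff [Finite σ] {R S : MvPolynomial σ ℂ} (hR : Irreducible R)
    (hS : Irreducible S) (h : ∀ a, eval a R = 0 ↔ eval a S = 0) :
    ∃ c : ℂ, c ≠ 0 ∧ S = C c * R := by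
  obtain ⟨u, hu⟩ := associated_of_dvd_dvd (dvd_of_forall_eval_eq_zero hR fun a => (h a).1)
    (dvd_of_forall_eval_eq_zero hS fun a => (h a).2)
  obtain ⟨c, hc, hc'⟩ := MvPolynomial.isUnit_iff_eq_C_of_isReduced.1 u.isUnit
  exact ⟨c, hc.ne_zero, by rw [← hu, hc', mul_comm]⟩

theorem irreducible_aeval_of_inverse {s t : σ → MvPolynomial σ ℂ} (hst : ∀ c, aeval s (t c) = X c)
    (hts : ∀ c, aeval t (s c) = X c) {R : MvPolynomial σ ℂ} (hR : Irreducible R) :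
    Irreducible (aeval t R) := by
  let e : MvPolynomial σ ℂ ≃ₐ[ℂ] MvPolynomial σ ℂ :=
    AlgEquiv.ofAlgHom (aeval t) (aeval s) (by ext1 c; simpa using hts c)
      (by ext1 c; simpa using hst c)
  exact (MulEquiv.irreducible_iff e).2 hR

end Associated

end

noncomputable section

/-! ### Common zeros of `n - 1` forms by Krull's height theorem -/

section KrullZero

variable {n : ℕ}

/-- The map killing the variables with index less than `k`. -/
def killVars (n k : ℕ) : MvPolynomial (Fin n) ℂ →ₐ[ℂ] MvPolynomial (Fin n) ℂ :=
  aeval fun j => if (j : ℕ) < k then 0 else X j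

instance isPrime_ker_killVars (n k : ℕ) : (RingHom.ker (killVars n k)).IsPrime :=
  RingHom.ker_isPrime _

/-- The kernels for `0, 1, …, k` form a chain of primes, strict because `X k` first enters at step
`k + 1`. -/
theorem le_height_ker_killVars (n k : ℕ) (hk : k ≤ n) :
    (k : ℕ∞) ≤ (RingHom.ker (killVars n k)).height := by
  induction k with
  | zero => simp
  | succ k ih =>
    refine le_trans ?_ (Ideal.height_add_one_le_of_lt_of_isPrime (I := RingHom.ker (killVars n k)) ?_)
    · push_cast
      gcongr
      exact ih (by omega)
    · have hcomp : (killVars n (k + 1)).comp (killVars n k) = killVars n (k + 1) := by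
        ext1 j
        simp only [killVars, AlgHom.comp_apply, aeval_X]
        split_ifs <;> (simp_all; try omega)
      refine lt_of_le_of_ne (fun p hp => ?_) fun h => ?_
      · rw [RingHom.mem_ker] at hp ⊢
        rw [← hcomp, AlgHom.comp_apply, hp, map_zero]
      · have : (X ⟨k, hk⟩ : MvPolynomial (Fin n) ℂ) ∈ RingHom.ker (killVars n (k + 1)) := by
          simp [killVars, RingHom.mem_ker]
        rw [← h, RingHom.mem_ker] at this
        simp [killVars] at this

/-- Fewer forms of positive degree than variables have a nontrivial common zero. -/
theorem exists_common_zero_of_ne {h : Fin n → MvPolynomial (Fin n) ℂ} {r : Fin n → ℕ}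
    (hr : ∀ i, 0 < r i) (hh : ∀ i, (h i).IsHomogeneous (r i)) (i₀ : Fin n) :
    ∃ x : Fin n → ℂ, x ≠ 0 ∧ ∀ i, i ≠ i₀ → eval x (h i) = 0 := by
  by_contra! hcon
  set S : Set (MvPolynomial (Fin n) ℂ) := h '' {i | i ≠ i₀} with hS
  set m := RingHom.ker (killVars n n) with hm
  have hSm : S ⊆ m := by
    rintro _ ⟨i, -, rfl⟩
    have : killVars n n = (aeval fun _ => 0) := by
      unfold killVars
      congr 1
      funext j
      simp
    simp only [hm, SetLike.mem_coe, RingHom.mem_ker, this]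
    rw [aeval_zero', constantCoeff_eq, (hh i).coeff_eq_zero (by simpa using (hr i).ne), map_zero]
  have hX : ∀ j, (X j : MvPolynomial (Fin n) ℂ) ∈ (Ideal.span S).radical := by
    intro j
    rw [← vanishingIdeal_zeroLocus_eq_radical (K := ℂ)]
    intro x hx
    rw [zeroLocus_span] at hx
    have : x = 0 := by
      by_contra h0
      obtain ⟨i, hi, hi'⟩ := hcon x h0
      exact hi' (by simpa [aeval_eq_eval] using hx (h i) ⟨i, hi, rfl⟩)
    simp [this]
  -- The radical contains all variables, so the ideal of the origin is minimal over the span. Its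
  -- height is then at most `n - 1`, the number of forms, but the chain of kernels gives at least
  -- `n`.
  have hmin : m ∈ (Ideal.span S).minimalPrimes := by
    refine ⟨⟨inferInstance, Ideal.span_le.2 hSm⟩, fun J ⟨hJ, hSJ⟩ _ p hp => ?_⟩
    have hXJ : ∀ j, (X j : MvPolynomial (Fin n) ℂ) ∈ J := fun j =>
      (hJ.radical_le_iff.2 hSJ) (hX j)
    have hdiff : ∀ p : MvPolynomial (Fin n) ℂ, p - killVars n n p ∈ J := by
      intro p
      rw [← Ideal.Quotient.mk_eq_mk_iff_sub_mem, ← AlgHom.coe_toRingHom, ← RingHom.comp_apply]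
      refine RingHom.congr_fun (MvPolynomial.ringHom_ext (fun a => ?_) fun j => ?_) p
      · simp [killVars]
      · simpa [killVars, Ideal.Quotient.eq_zero_iff_mem] using hXJ j
    have := hdiff p
    rwa [RingHom.mem_ker.1 hp, sub_zero] at this
  have h1 := Ideal.height_le_card_of_mem_minimalPrimes_span (Set.toFinite S) hmin
  have h2 : S.ncard ≤ n - 1 := by
    refine (Set.ncard_image_le (Set.toFinite _)).trans ?_
    have : {i : Fin n | i ≠ i₀} = {i₀}ᶜ := rfl
    rw [this, Set.ncard_compl]
    simp
  have h3 := (le_height_ker_killVars n n le_rfl).trans h1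
  have := i₀.pos
  norm_cast at h3
  omega

end KrullZero

/-! ### A principality criterion for primes in polynomial rings -/

section PrincipalPrime

/-- A nonzero prime of `B[X]` meeting `B` in zero is principal. -/
theorem exists_irreducible_span_eq_of_comap_C_eq_bot {B : Type*} [CommRing B] [IsDomain B]
    [UniqueFactorizationMonoid B] (P : Ideal (Polynomial B)) [hP : P.IsPrime] (h0 : P ≠ ⊥)
    (hC : ∀ b : B, Polynomial.C b ∈ P → b = 0) : ∃ R, Irreducible R ∧ P = Ideal.span {R} := by
  have : IsGCDMonoid B := inferInstance
  obtain ⟨R, hRP, hR⟩ := hP.exists_mem_prime_of_ne_bot h0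
  have hRi := hR.irreducible
  have hdeg : R.natDegree ≠ 0 := by
    intro h
    rw [Polynomial.eq_C_of_natDegree_eq_zero h] at hRP
    rw [Polynomial.eq_C_of_natDegree_eq_zero h, hC _ hRP, map_zero] at hR
    exact hR.ne_zero rfl
  -- Gauss's lemma: `R` has positive degree, so it is primitive and remains irreducible over the
  -- fraction field.
  have hprim : R.IsPrimitive := hRi.isPrimitive hdeg
  refine ⟨R, hRi, le_antisymm (fun a ha => ?_) (by simpa [Ideal.span_le] using hRP)⟩
  rw [Ideal.mem_span_singleton]
  let K := FractionRing B
  have hRK : Irreducible (R.map (algebraMap B K)) :=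
    (hprim.irreducible_iff_irreducible_map_fraction_map (K := K)).1 hRi
  refine hprim.dvd_of_fraction_map_dvd_fraction_map (K := K) ?_
  -- Otherwise a Bézout identity over `K`, with denominators cleared, puts the nonzero constant `b *
  -- c` into `P`.
  by_contra hdvd
  obtain ⟨u, w, huw⟩ := (hRK.coprime_iff_not_dvd.2 hdvd)
  obtain ⟨b, hb, hb'⟩ := IsLocalization.integerNormalization_spec (nonZeroDivisors B) u
  obtain ⟨c, hc, hc'⟩ := IsLocalization.integerNormalization_spec (nonZeroDivisors B) w
  set u' := IsLocalization.integerNormalization (nonZeroDivisors B) u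
  set w' := IsLocalization.integerNormalization (nonZeroDivisors B) w
  have key : Polynomial.C c * u' * R + Polynomial.C b * w' * a = Polynomial.C (b * c) := by
    apply Polynomial.map_injective _ (IsFractionRing.injective B K)
    simp only [Polynomial.map_add, Polynomial.map_mul, hb', hc', Polynomial.map_C, Algebra.smul_def,
      Polynomial.algebraMap_apply, map_mul, IsScalarTower.algebraMap_apply B K (Polynomial K)]
    linear_combination (Polynomial.C (algebraMap B K b) * Polynomial.C (algebraMap B K c)) * huw
  have := hC (b * c) (key ▸ P.add_mem (P.mul_mem_left _ hRP) (P.mul_mem_left _ ha))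
  exact nonZeroDivisors.ne_zero (mul_mem hb hc) this

/-- A nonzero prime of a polynomial ring which contains no nonzero polynomial free of one of the
variables is principal. -/
theorem exists_irreducible_span_eq_of_free {σ : Type*} (v : σ) (P : Ideal (MvPolynomial σ ℂ))
    [hP : P.IsPrime] (h0 : P ≠ ⊥)
    (hfree : ∀ Q ∈ P, (∀ a b : σ → ℂ, (∀ c, c ≠ v → a c = b c) → eval a Q = eval b Q) → Q = 0) :
    ∃ R, Irreducible R ∧ P = Ideal.span {R} := by
  classical
  let e : MvPolynomial σ ℂ ≃ₐ[ℂ] Polynomial (MvPolynomial {c // c ≠ v} ℂ) :=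
    (renameEquiv ℂ (Equiv.optionSubtypeNe v).symm).trans (optionEquivLeft ℂ _)
  have hsymm : ∀ b, e.symm (Polynomial.C b) = rename Subtype.val b := by
    intro b
    rw [AlgEquiv.symm_apply_eq]
    induction b using MvPolynomial.induction_on with
    | C a => simp [e]
    | add p q hp hq => simp only [map_add, hp, hq]
    | mul_X p i hp =>
      simp only [map_mul, hp]
      congr 1
      simp [e, Equiv.optionSubtypeNe_symm_of_ne i.2]
  let P' := P.comap (e.symm : Polynomial (MvPolynomial {c // c ≠ v} ℂ) →+* MvPolynomial σ ℂ)
  have hmem : ∀ p, p ∈ P' ↔ e.symm p ∈ P := fun p => Iff.rfl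
  have h0' : P' ≠ ⊥ := by
    obtain ⟨p, hp, hp0⟩ := Submodule.exists_mem_ne_zero_of_ne_bot h0
    intro h
    have : e p ∈ P' := by simpa [hmem] using hp
    rw [h, Ideal.mem_bot] at this
    exact hp0 (by simpa using this)
  have hC' : ∀ b, Polynomial.C b ∈ P' → b = 0 := by
    intro b hb
    rw [hmem, hsymm] at hb
    have := hfree _ hb fun x y hxy => by
      simp only [eval_rename]
      congr 2
      funext c
      exact hxy c.1 c.2
    exact rename_injective _ Subtype.val_injective (by simpa using this)
  obtain ⟨R, hR, hR'⟩ := exists_irreducible_span_eq_of_comap_C_eq_bot P' h0' hC'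
  refine ⟨e.symm R, (MulEquiv.irreducible_iff e.symm).2 hR, ?_⟩
  ext p
  rw [Ideal.mem_span_singleton, ← e.symm_apply_apply p, ← hmem, hR', Ideal.mem_span_singleton,
    map_dvd_iff]

end PrincipalPrime

end

noncomputable section

variable {n : ℕ} {r : Fin n → ℕ}

theorem eq_sum_monomial_of_isHomogeneous {A : Type*} [CommRing A] {p : MvPolynomial (Fin n) A}
    {N : ℕ} (hp : p.IsHomogeneous N) :
    p = ∑ β : {β : Fin n →₀ ℕ // β.degree = N}, monomial β.1 (p.coeff β.1) := by
  classical
  ext α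
  simp only [coeff_sum, coeff_monomial]
  by_cases hα : α.degree = N
  · rw [Finset.sum_eq_single ⟨α, hα⟩] <;> simp +contextual [Subtype.ext_iff]
  · rw [hp.coeff_eq_zero hα, Finset.sum_eq_zero]
    rintro ⟨β, hβ⟩ -
    rw [if_neg]
    rintro rfl
    exact hα hβ

theorem eval_eq_sum_of_isHomogeneous {p : MvPolynomial (Fin n) ℂ}
    {N : ℕ} (hp : p.IsHomogeneous N) (x : Fin n → ℂ) :
    eval x p = ∑ β : {β : Fin n →₀ ℕ // β.degree = N}, p.coeff β.1 * ∏ k, x k ^ β.1 k := by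
  conv_lhs => rw [eq_sum_monomial_of_isHomogeneous hp]
  simp [eval_monomial, Finsupp.prod_fintype]

/-! ### Determinants vanishing at all solvable systems -/

section Macaulay

/-- The determinant of the matrix expressing the combinations `∑ i, q β i * h i`, for `β` a
monomial of degree `N`, through the monomials of degree `N`. -/
def combDet (r : Fin n → ℕ) (N : ℕ)
    (q : {β : Fin n →₀ ℕ // β.degree = N} → Fin n → MvPolynomial (Fin n) ℂ) :
    MvPolynomial (CoeffIndex r) ℂ :=
  (Matrix.of fun β γ : {β : Fin n →₀ ℕ // β.degree = N} =>
    coeff γ.1 (∑ i, map C (q β i) * genericSystem r i)).det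

theorem eval_combDet (N : ℕ)
    (q : {β : Fin n →₀ ℕ // β.degree = N} → Fin n → MvPolynomial (Fin n) ℂ)
    (a : CoeffIndex r → ℂ) :
    eval a (combDet r N q) =
      (Matrix.of fun β γ : {β : Fin n →₀ ℕ // β.degree = N} =>
        coeff γ.1 (∑ i, q β i * ofCoeff a i)).det := by
  rw [combDet, RingHom.map_det]
  congr 1
  ext β γ
  have hC : (eval a).comp (C : ℂ →+* MvPolynomial (CoeffIndex r) ℂ) = RingHom.id ℂ := by
    ext; simp
  simp only [RingHom.mapMatrix_apply, Matrix.map_apply, Matrix.of_apply, ← coeff_map, map_sum,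
    map_mul, map_genericSystem, map_map, hC, map_id]

/-- At a common zero `x` the vector of all degree `N` monomials in `x` lies in the kernel of the
matrix; its entries `x k ^ N` show that it is nonzero. -/
theorem eval_combDet_eq_zero {N : ℕ}
    {q : {β : Fin n →₀ ℕ // β.degree = N} → Fin n → MvPolynomial (Fin n) ℂ} {m : Fin n → ℕ}
    (hm : ∀ i, m i + r i = N) (hq : ∀ β i, (q β i).IsHomogeneous (m i))
    {a : CoeffIndex r → ℂ} (ha : HasZero (ofCoeff a)) : eval a (combDet r N q) = 0 := by
  classical
  obtain ⟨x, hx, hz⟩ := ha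
  rw [eval_combDet, ← Matrix.exists_mulVec_eq_zero_iff]
  refine ⟨fun β => ∏ k, x k ^ β.1 k, fun h => hx ?_, ?_⟩
  · funext k
    by_contra hk
    have := congr_fun h ⟨Finsupp.single k N, by simp⟩
    simp only [Pi.zero_apply, Finset.prod_eq_zero_iff] at this
    obtain ⟨j, -, hj⟩ := this
    rcases eq_or_ne j k with rfl | hjk
    · exact hk (eq_zero_of_pow_eq_zero hj)
    · simp [hjk.symm] at hj
  · funext β
    have hom : (∑ i, q β i * ofCoeff a i).IsHomogeneous N :=
      IsHomogeneous.sum _ _ _ fun i _ => hm i ▸ (hq β i).mul (ofCoeff_isHomogeneous a i)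
    have := eval_eq_sum_of_isHomogeneous hom x
    simp only [map_sum, map_mul, hz, mul_zero, Finset.sum_const_zero] at this
    simpa [Matrix.mulVec, dotProduct] using this.symm

theorem homogeneousComponent_mul_of_isHomogeneous {p f : MvPolynomial (Fin n) ℂ} {k N : ℕ}
    (hf : f.IsHomogeneous k) (hk : k ≤ N) :
    homogeneousComponent N (p * f) = homogeneousComponent (N - k) p * f := by
  let _ := MvPolynomial.gradedAlgebra (σ := Fin n) (R := ℂ)
  rw [← decomposition.decompose'_apply, ← decomposition.decompose'_apply]
  exact DirectSum.coe_decompose_mul_of_right_mem_of_le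
    (homogeneousSubmodule (Fin n) ℂ) (a := p) (b := f) (n := N) (i := k) hf hk

/-- Without a nontrivial zero, the Nullstellensatz puts all monomials of some large degree `N` into
the ideal of the forms. Rows chosen accordingly make the matrix the identity at `a`. -/
theorem exists_combDet_eval_eq_one (a : CoeffIndex r → ℂ) (ha : ¬ HasZero (ofCoeff a)) :
    ∃ D : MvPolynomial (CoeffIndex r) ℂ,
      (∀ b, HasZero (ofCoeff b) → eval b D = 0) ∧ eval a D = 1 := by
  set I := Ideal.span (Set.range (ofCoeff a)) with hI
  have hX : ∀ j, ∃ M, (X j : MvPolynomial (Fin n) ℂ) ^ M ∈ I := by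
    intro j
    suffices (X j : MvPolynomial (Fin n) ℂ) ∈ I.radical from this
    rw [← vanishingIdeal_zeroLocus_eq_radical (K := ℂ)]
    intro x hx
    rw [zeroLocus_span] at hx
    have : x = 0 := by
      by_contra h0
      exact ha ⟨x, h0, fun i => by simpa [aeval_eq_eval] using hx _ ⟨i, rfl⟩⟩
    simp [this]
  choose M hM using hX
  -- The first sum makes some `M j ≤ β j` by pigeonhole; the second makes every `N - r i` an honest
  -- subtraction.
  set N := ∑ j, M j + ∑ i, r i + 1 with hN
  have hrN : ∀ i, r i ≤ N := fun i => by
    have := Finset.single_le_sum (f := r) (fun _ _ => Nat.zero_le _) (Finset.mem_univ i)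
    omega
  have hmon : ∀ β : {β : Fin n →₀ ℕ // β.degree = N}, ∃ c : Fin n → MvPolynomial (Fin n) ℂ,
      ∑ i, c i * ofCoeff a i = monomial β.1 1 := by
    intro β
    rw [← Ideal.mem_span_range_iff_exists_fun]
    obtain ⟨j, hj⟩ : ∃ j, M j ≤ β.1 j := by
      by_contra! hlt
      have h1 : ∑ j, β.1 j ≤ ∑ j, M j := Finset.sum_le_sum fun j _ => (hlt j).le
      have h2 := β.2
      rw [Finsupp.degree_eq_sum] at h2
      omega
    have : (monomial β.1 (1 : ℂ)) = monomial (β.1 - Finsupp.single j (M j)) 1 * X j ^ M j := by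
      rw [X_pow_eq_monomial, monomial_mul, mul_one, tsub_add_cancel_of_le]
      simpa using hj
    rw [this]
    exact Ideal.mul_mem_left _ _ (hM j)
  choose c hc using hmon
  -- Only the part of degree `N - r i` of each cofactor matters, and homogeneous cofactors are
  -- needed for vanishing at solvable systems.
  refine ⟨combDet r N fun β i => homogeneousComponent (N - r i) (c β i), fun b hb =>
    eval_combDet_eq_zero (m := fun i => N - r i) (fun i => Nat.sub_add_cancel (hrN i))
      (fun β i => homogeneousComponent_isHomogeneous _ _) hb, ?_⟩
  classical
  rw [eval_combDet, ← Matrix.det_one (n := {β : Fin n →₀ ℕ // β.degree = N})]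
  congr 1
  ext β γ
  have : ∑ i, homogeneousComponent (N - r i) (c β i) * ofCoeff a i = monomial β.1 1 := by
    rw [← homogeneousComponent_eq_self (isHomogeneous_monomial (1 : ℂ) β.2), ← hc, map_sum]
    exact Finset.sum_congr rfl fun i _ =>
      (homogeneousComponent_mul_of_isHomogeneous (ofCoeff_isHomogeneous a i) (hrN i)).symm
  rw [Matrix.of_apply, this, coeff_monomial, Matrix.one_apply]
  simp [Subtype.ext_iff]

end Macaulay

/-! ### Moving a zero off a coordinate hyperplane -/

section Perturb

theorem transvection_X_map (i j : Fin n) (t : ℂ) :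
    (Matrix.transvection i j (Polynomial.X : Polynomial ℂ)).map (Polynomial.evalRingHom t) =
      Matrix.transvection i j t := by
  ext k l
  simp only [Matrix.transvection, Matrix.map_apply, Matrix.add_apply, Matrix.one_apply,
    Matrix.single_apply]
  split_ifs <;> simp

/-- To vanish at all systems whose forms with index in `S` have a common nontrivial zero, it
suffices to vanish where such a zero has nonzero `i₀`-th coordinate. -/
theorem eval_eq_zero_of_forall_ne_zero (S : Set (Fin n)) (i₀ : Fin n)
    {Q : MvPolynomial (CoeffIndex r) ℂ}
    (hQ : ∀ (a : CoeffIndex r → ℂ) (x : Fin n → ℂ), x i₀ ≠ 0 →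
      (∀ i ∈ S, eval x (ofCoeff a i) = 0) → eval a Q = 0)
    (a : CoeffIndex r → ℂ) (x : Fin n → ℂ) (hx : x ≠ 0)
    (hz : ∀ i ∈ S, eval x (ofCoeff a i) = 0) : eval a Q = 0 := by
  by_cases hx0 : x i₀ = 0
  swap
  · exact hQ a x hx0 hz
  obtain ⟨j, hj⟩ := Function.ne_iff.1 hx
  have hij : i₀ ≠ j := by
    rintro rfl
    exact hj hx0
  -- For `t ≠ 0` the transvected system has a zero with `i₀`-th coordinate `-t * x j ≠ 0`. So `Q`
  -- vanishes along the curve for `t ≠ 0`, hence also at `t = 0`.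
  set H : Fin n → MvPolynomial (Fin n) (Polynomial ℂ) := fun i =>
    linSubst (Matrix.transvection i₀ j Polynomial.X) (map Polynomial.C (ofCoeff a i)) with hH
  have hmap : ∀ t i, map (Polynomial.evalRingHom t) (H i) =
      linSubst (Matrix.transvection i₀ j t) (ofCoeff a i) := by
    intro t i
    have hC : (Polynomial.evalRingHom t).comp Polynomial.C = RingHom.id ℂ := by ext; simp
    rw [hH, map_linSubst, map_map, hC, map_id]
    rw [transvection_X_map]
  have hzero : ∀ t, t ≠ 0 → (curvePoly Q H).eval t = 0 := by
    intro t ht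
    rw [eval_curvePoly]
    refine hQ _ ((Matrix.transvection i₀ j (-t)).mulVec x) ?_ fun i hi => ?_
    · have : (Matrix.transvection i₀ j (-t)).mulVec x i₀ = x i₀ - t * x j := by
        simp [Matrix.transvection, Matrix.add_mulVec, Matrix.single_mulVec, sub_eq_add_neg]
      rw [this, hx0]
      simpa using ⟨ht, hj⟩
    · rw [ofCoeff_systemCoeff fun i => by
        rw [hmap]; exact linSubst_isHomogeneous _ (ofCoeff_isHomogeneous a i)]
      rw [hmap, eval_linSubst, Matrix.mulVec_mulVec,
        Matrix.transvection_mul_transvection_same _ _ hij]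
      simpa using hz i hi
  have h0 : curvePoly Q H = 0 := by
    refine Polynomial.eq_zero_of_infinite_isRoot _ (Set.Infinite.mono (s := {0}ᶜ) ?_ ?_)
    · exact fun t ht => hzero t ht
    · exact (Set.finite_singleton (0 : ℂ)).infinite_compl
  have := eval_curvePoly Q H 0
  simp only [h0, hmap, Matrix.transvection_zero, linSubst_one, Polynomial.eval_zero] at this
  rw [this, ← systemCoeff_ofCoeff a]
  simp only [systemCoeff_ofCoeff]

end Perturb

end

/-! ### Existence and uniqueness of the resultant -/

noncomputable section

variable {n : ℕ} {r : Fin n → ℕ}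

theorem eval_ofCoeff (a : CoeffIndex r → ℂ) (x : Fin n → ℂ) (i : Fin n) :
    eval x (ofCoeff a i) =
      ∑ α : {α : Fin n →₀ ℕ // α.degree = r i}, a ⟨i, α⟩ * ∏ k, x k ^ α.1 k := by
  rw [eval_eq_sum_of_isHomogeneous (ofCoeff_isHomogeneous a i)]
  exact Finset.sum_congr rfl fun α _ => by rw [coeff_ofCoeff a ⟨i, α⟩]

/-- The label of the coefficient of `x_{i₀} ^ r i` in the `i`-th form. -/
def powIndex (r : Fin n → ℕ) (i₀ i : Fin n) : CoeffIndex r :=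
  ⟨i, Finsupp.single i₀ (r i), by simp⟩

theorem sum_ite_powIndex [DecidableEq (CoeffIndex r)] (i₀ i : Fin n) (x : Fin n → ℂ) (y : ℂ) :
    ∑ α : {α : Fin n →₀ ℕ // α.degree = r i},
      (if (⟨i, α⟩ : CoeffIndex r) = powIndex r i₀ i then y else 0) * ∏ k, x k ^ α.1 k =
        y * x i₀ ^ r i := by
  rw [Finset.sum_eq_single (⟨Finsupp.single i₀ (r i), by simp⟩ : {α : Fin n →₀ ℕ // α.degree = r i})]
  · rw [powIndex, if_pos rfl, Finset.prod_eq_single i₀]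
    · simp
    · intro k _ hk
      simp [hk.symm]
    · simp
  · intro α _ hα
    rw [if_neg, zero_mul]
    intro h
    exact hα (by injection h with h1 h2)
  · simp

open Classical in
/-- Subtracting a multiple of `x_{i₀} ^ r i` from each form to make a given point a zero. -/
def forceZero (r : Fin n → ℕ) (i₀ : Fin n) :
    MvPolynomial (CoeffIndex r) ℂ →ₐ[ℂ] MvPolynomial (CoeffIndex r ⊕ Fin n) ℂ :=
  aeval fun c => X (Sum.inr i₀) ^ r c.1 * X (Sum.inl c) -
    if c = powIndex r i₀ c.1 then
      ∑ α : {α : Fin n →₀ ℕ // α.degree = r c.1},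
        X (Sum.inl ⟨c.1, α⟩) * ∏ k, X (Sum.inr k) ^ α.1 k
    else 0

open Classical in
/-- The coefficients of the systems parametrized by `forceZero`. -/
def forcedCoeff (i₀ : Fin n) (a : CoeffIndex r → ℂ) (x : Fin n → ℂ) (c : CoeffIndex r) : ℂ :=
  x i₀ ^ r c.1 * a c - if c = powIndex r i₀ c.1 then eval x (ofCoeff a c.1) else 0

theorem eval_forceZero (i₀ : Fin n) (a : CoeffIndex r → ℂ) (x : Fin n → ℂ)
    (Q : MvPolynomial (CoeffIndex r) ℂ) :
    eval (Sum.elim a x) (forceZero r i₀ Q) = eval (forcedCoeff i₀ a x) Q := by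
  have : (eval (Sum.elim a x)).comp (forceZero r i₀ : _ →+* _) = eval (forcedCoeff i₀ a x) := by
    refine MvPolynomial.ringHom_ext (fun c => by simp [forceZero]) fun c => ?_
    simp only [forceZero, RingHom.comp_apply, RingHom.coe_coe, aeval_X, forcedCoeff, eval_X,
      eval_ofCoeff]
    split_ifs <;> simp
  exact RingHom.congr_fun this Q

theorem eval_ofCoeff_forcedCoeff (i₀ : Fin n) (a : CoeffIndex r → ℂ) (x : Fin n → ℂ) (i : Fin n) :
    eval x (ofCoeff (forcedCoeff i₀ a x) i) = 0 := by
  classical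
  rw [eval_ofCoeff]
  simp only [forcedCoeff, sub_mul, Finset.sum_sub_distrib, mul_assoc, ← Finset.mul_sum]
  rw [← eval_ofCoeff, sum_ite_powIndex, mul_comm, sub_self]

/-- The parametrization reaches every system with a zero whose `i₀`-th coordinate is nonzero;
`eval_eq_zero_of_forall_ne_zero` covers the other zeros. Being a kernel into a domain, the ideal
described here is prime. -/
theorem mem_ker_forceZero_iff (i₀ : Fin n) (Q : MvPolynomial (CoeffIndex r) ℂ) :
    Q ∈ RingHom.ker (forceZero r i₀) ↔ ∀ a, HasZero (ofCoeff a) → eval a Q = 0 := by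
  rw [RingHom.mem_ker]
  constructor
  · rintro hQ a ⟨x, hx, hz⟩
    refine eval_eq_zero_of_forall_ne_zero Set.univ i₀ ?_ a x hx fun i _ => hz i
    clear! a x
    intro a x hx hz
    -- `x` is already a zero, so the correction term vanishes and only the scaling has to be undone.
    have : forcedCoeff i₀ (fun c => (x i₀ ^ r c.1)⁻¹ * a c) x = a := by
      funext c
      have h0 : eval x (ofCoeff (fun c => (x i₀ ^ r c.1)⁻¹ * a c) c.1) = 0 := by
        have := hz c.1 trivial
        rw [eval_ofCoeff] at this ⊢
        simp only [mul_assoc, ← Finset.mul_sum, this, mul_zero]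
      rw [forcedCoeff, h0, ite_self, sub_zero, mul_inv_cancel_left₀ (pow_ne_zero _ hx)]
    rw [← this, ← eval_forceZero, hQ, map_zero]
  · intro hQ
    -- The extra factor disposes of the points with `x i₀ = 0`, where `x` could be the origin.
    have : forceZero r i₀ Q * X (Sum.inr i₀) = 0 := by
      refine MvPolynomial.funext fun y => ?_
      obtain ⟨a, x, rfl⟩ : ∃ a x, y = Sum.elim a x :=
        ⟨y ∘ Sum.inl, y ∘ Sum.inr, (Sum.elim_comp_inl_inr y).symm⟩
      simp only [map_mul, eval_forceZero, eval_X, Sum.elim_inr, map_zero, mul_eq_zero]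
      by_cases hx : x i₀ = 0
      · exact Or.inr hx
      · refine Or.inl (hQ _ ⟨x, fun h => hx (by simp [h]), fun i => ?_⟩)
        exact eval_ofCoeff_forcedCoeff i₀ a x i
    exact (mul_eq_zero.1 this).resolve_right (X_ne_zero _)

theorem not_hasZero_X_pow (r : Fin n → ℕ) :
    ¬ HasZero fun i : Fin n => (X i ^ r i : MvPolynomial (Fin n) ℂ) := by
  rintro ⟨x, hx, hz⟩
  refine hx (funext fun i => ?_)
  have := hz i
  rw [map_pow, eval_X] at this
  exact eq_zero_of_pow_eq_zero this

theorem eval_update_ofCoeff [DecidableEq (CoeffIndex r)] (i₀ i : Fin n) (a : CoeffIndex r → ℂ)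
    (x : Fin n → ℂ) (s : ℂ) :
    eval x (ofCoeff (Function.update a (powIndex r i₀ i₀) s) i) =
      eval x (ofCoeff a i) + if i = i₀ then (s - a (powIndex r i₀ i₀)) * x i₀ ^ r i₀ else 0 := by
  split_ifs with hi
  · subst hi
    rw [← sum_ite_powIndex, eval_ofCoeff, eval_ofCoeff, ← Finset.sum_add_distrib]
    refine Finset.sum_congr rfl fun α _ => ?_
    rw [← add_mul, Function.update_apply]
    split_ifs with h
    · rw [h]
      ring
    · ring
  · rw [eval_ofCoeff, eval_ofCoeff, add_zero]
    refine Finset.sum_congr rfl fun α _ => ?_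
    rw [Function.update_of_ne fun h => hi (congrArg Sigma.fst h)]

/-- The forms other than the `i₀`-th share a nontrivial zero. Changing the one coefficient that `Q`
ignores makes the `i₀`-th form vanish there too. -/
theorem eq_zero_of_free (hr : ∀ i, 0 < r i) (i₀ : Fin n) {Q : MvPolynomial (CoeffIndex r) ℂ}
    (hQ : ∀ a, HasZero (ofCoeff a) → eval a Q = 0)
    (hfree : ∀ a b : CoeffIndex r → ℂ, (∀ c, c ≠ powIndex r i₀ i₀ → a c = b c) →
      eval a Q = eval b Q) : Q = 0 := by
  classical
  refine MvPolynomial.funext fun a => ?_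
  rw [map_zero]
  obtain ⟨x, hx, hz⟩ := exists_common_zero_of_ne hr (ofCoeff_isHomogeneous a) i₀
  refine eval_eq_zero_of_forall_ne_zero {i | i ≠ i₀} i₀ ?_ a x hx hz
  clear! a x
  intro a x hx hz
  set s := a (powIndex r i₀ i₀) - eval x (ofCoeff a i₀) / x i₀ ^ r i₀ with hs
  rw [hfree a (Function.update a (powIndex r i₀ i₀) s) fun c hc =>
    (Function.update_of_ne hc _ _).symm]
  refine hQ _ ⟨x, fun h => hx (by simp [h]), fun i => ?_⟩
  rw [eval_update_ofCoeff]
  split_ifs with hi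
  · subst hi
    have := pow_ne_zero (r i) hx
    rw [hs]
    field_simp
    ring
  · rw [hz i hi, add_zero]

/-- Existence of resultants. -/
theorem exists_isResultant (hr : ∀ i, 0 < r i) (i₀ : Fin n) : ∃ R, IsResultant r R := by
  have hnz : ¬ HasZero fun i : Fin n => (X i ^ r i : MvPolynomial (Fin n) ℂ) :=
    not_hasZero_X_pow r
  have hX : ofCoeff (systemCoeff r fun i => X i ^ r i) =
      fun i : Fin n => (X i ^ r i : MvPolynomial (Fin n) ℂ) :=
    ofCoeff_systemCoeff fun i => by simpa using (isHomogeneous_X ℂ i).pow (r i)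
  have hP : (RingHom.ker (forceZero r i₀)).IsPrime := RingHom.ker_isPrime _
  obtain ⟨R, hR, hPR⟩ := exists_irreducible_span_eq_of_free (powIndex r i₀ i₀)
    (RingHom.ker (forceZero r i₀))
    (by
      obtain ⟨D, hD, hD1⟩ := exists_combDet_eval_eq_one _ (hX ▸ hnz)
      intro h
      have : D ∈ RingHom.ker (forceZero r i₀) := (mem_ker_forceZero_iff i₀ D).2 hD
      rw [h, Ideal.mem_bot] at this
      simp [this] at hD1)
    (fun Q hQ hf => eq_zero_of_free hr i₀ ((mem_ker_forceZero_iff i₀ Q).1 hQ) hf)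
  have hzero : ∀ a, eval a R = 0 ↔ HasZero (ofCoeff a) := by
    intro a
    constructor
    · intro h
      by_contra hn
      obtain ⟨D, hD, hD1⟩ := exists_combDet_eval_eq_one _ hn
      -- `D` is a multiple of `R`, so a zero of `R` at the unsolvable `a` would contradict `eval a D
      -- = 1`.
      have : D ∈ Ideal.span {R} := hPR ▸ (mem_ker_forceZero_iff i₀ D).2 hD
      obtain ⟨E, rfl⟩ := Ideal.mem_span_singleton.1 this
      simp [h] at hD1
    · exact (mem_ker_forceZero_iff i₀ R).1 (hPR ▸ Ideal.mem_span_singleton_self R) a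
  have hc : eval (systemCoeff r fun i => X i ^ r i) R ≠ 0 := by
    rw [Ne, hzero, hX]
    exact hnz
  set c := eval (systemCoeff r fun i => X i ^ r i) R with hcdef
  have hu : IsUnit (C c⁻¹ : MvPolynomial (CoeffIndex r) ℂ) :=
    (isUnit_iff_ne_zero.2 (inv_ne_zero hc)).map C
  refine ⟨C c⁻¹ * R, (irreducible_isUnit_mul hu).2 hR, fun h hh => ?_, ?_⟩
  · rw [map_mul, eval_C, mul_eq_zero, or_iff_right (inv_ne_zero hc), hzero, ofCoeff_systemCoeff hh]
    rfl
  · rw [map_mul, eval_C, ← hcdef, inv_mul_cancel₀ hc]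

theorem IsResultant.eval_eq_zero_iff_hasZero {R : MvPolynomial (CoeffIndex r) ℂ}
    (hR : IsResultant r R) (a : CoeffIndex r → ℂ) : eval a R = 0 ↔ HasZero (ofCoeff a) := by
  rw [HasZero, ← hR.eval_eq_zero_iff _ (ofCoeff_isHomogeneous a), systemCoeff_ofCoeff]

theorem IsResultant.unique {R S : MvPolynomial (CoeffIndex r) ℂ} (hR : IsResultant r R)
    (hS : IsResultant r S) : R = S := by
  obtain ⟨c, -, rfl⟩ := exists_C_mul_of_forall_eval_eq_zero_iff hR.irreducible hS.irreducible
    fun a => by rw [hR.eval_eq_zero_iff_hasZero, hS.eval_eq_zero_iff_hasZero]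
  have := hS.eval_X_pow
  rw [map_mul, hR.eval_X_pow, eval_C, mul_one] at this
  rw [this, C_1, one_mul]

theorem isResultant_resultantPoly (hr : ∀ i, 0 < r i) (i₀ : Fin n) :
    IsResultant r (resultantPoly r) := by
  have h := exists_isResultant hr i₀
  rw [resultantPoly, dif_pos h]
  exact h.choose_spec

end

/-! ### Changes of coefficients multiply the resultant by a constant -/

noncomputable section

variable {n : ℕ} {r : Fin n → ℕ}

theorem eval_aeval_eq {σ τ : Type*} (s : σ → MvPolynomial τ ℂ) (a : τ → ℂ) (p : MvPolynomial σ ℂ) :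
    eval a (aeval s p) = eval (fun c => eval a (s c)) p := by
  induction p using MvPolynomial.induction_on with
  | C a => simp
  | add p q hp hq => simp only [map_add, hp, hq]
  | mul_X p i hp => simp only [map_mul, hp, aeval_X, eval_X]

/-- An invertible polynomial change of the coefficients which preserves the systems with a
nontrivial zero multiplies the resultant by a constant. -/
theorem IsResultant.exists_eval_eq_mul {R : MvPolynomial (CoeffIndex r) ℂ} (hR : IsResultant r R)
    {s t : CoeffIndex r → MvPolynomial (CoeffIndex r) ℂ}
    (hst : ∀ a c, eval (fun c => eval a (s c)) (t c) = a c)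
    (hts : ∀ a c, eval (fun c => eval a (t c)) (s c) = a c)
    (hz : ∀ a, HasZero (ofCoeff fun c => eval a (t c)) ↔ HasZero (ofCoeff a)) :
    ∃ c : ℂ, ∀ a, eval (fun c => eval a (t c)) R = c * eval a R := by
  have hirr : Irreducible (aeval t R) := by
    refine irreducible_aeval_of_inverse (s := s) (fun c => ?_) (fun c => ?_) hR.irreducible
    · exact MvPolynomial.funext fun a => by rw [eval_aeval_eq, hst, eval_X]
    · exact MvPolynomial.funext fun a => by rw [eval_aeval_eq, hts, eval_X]
  obtain ⟨c, -, hc⟩ := exists_C_mul_of_forall_eval_eq_zero_iff hR.irreducible hirr fun a => by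
    rw [eval_aeval_eq, hR.eval_eq_zero_iff_hasZero, hR.eval_eq_zero_iff_hasZero, hz]
  exact ⟨c, fun a => by rw [← eval_aeval_eq, hc, map_mul, eval_C]⟩

/-- The constant is read off at the normalizing system of pure powers. -/
theorem IsResultant.eval_linSubst {R : MvPolynomial (CoeffIndex r) ℂ} (hR : IsResultant r R)
    {G : Matrix (Fin n) (Fin n) ℂ} (hG : G.det ≠ 0) {h : Fin n → MvPolynomial (Fin n) ℂ}
    (hh : ∀ i, (h i).IsHomogeneous (r i)) :
    eval (systemCoeff r fun i => linSubst G (h i)) R =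
      eval (systemCoeff r fun i => linSubst G (X i ^ r i)) R * eval (systemCoeff r h) R := by
  let t (G : Matrix (Fin n) (Fin n) ℂ) (c : CoeffIndex r) : MvPolynomial (CoeffIndex r) ℂ :=
    coeff c.2.1 (linSubst (G.map C) (genericSystem r c.1))
  have ht : ∀ (G : Matrix (Fin n) (Fin n) ℂ) (a : CoeffIndex r → ℂ),
      (fun c => eval a (t G c)) = systemCoeff r fun i => linSubst G (ofCoeff a i) := by
    intro G a
    funext c
    have hGC : (G.map (C : ℂ → MvPolynomial (CoeffIndex r) ℂ)).map (eval a) = G := by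
      ext; simp
    simp only [t, ← coeff_map, map_linSubst, map_genericSystem, hGC, systemCoeff]
  have hof : ∀ (G : Matrix (Fin n) (Fin n) ℂ) (a : CoeffIndex r → ℂ),
      ofCoeff (systemCoeff r fun i => linSubst G (ofCoeff a i)) =
        fun i => linSubst G (ofCoeff a i) := fun G a =>
    ofCoeff_systemCoeff fun i => linSubst_isHomogeneous G (ofCoeff_isHomogeneous a i)
  have hinv : ∀ (G H : Matrix (Fin n) (Fin n) ℂ), G * H = 1 → ∀ a c,
      eval (fun c => eval a (t G c)) (t H c) = a c := by
    intro G H hGH a c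
    have := congr_fun (ht H (fun c => eval a (t G c))) c
    rw [this, ht, hof]
    simp only [linSubst_linSubst, hGH, linSubst_one, systemCoeff_ofCoeff]
  have hu := isUnit_iff_ne_zero.2 hG
  obtain ⟨c, hc⟩ := hR.exists_eval_eq_mul (s := t G⁻¹) (t := t G)
    (hinv _ _ (G.nonsing_inv_mul hu)) (hinv _ _ (G.mul_nonsing_inv hu))
    (fun a => by
      rw [ht, hof]
      exact ⟨fun hz => hz.of_linSubst hG, fun hz => hz.linSubst hG⟩)
  have hc' : ∀ {h : Fin n → MvPolynomial (Fin n) ℂ}, (∀ i, (h i).IsHomogeneous (r i)) →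
      eval (systemCoeff r fun i => linSubst G (h i)) R = c * eval (systemCoeff r h) R := by
    intro h hh
    rw [← hc, ht, ofCoeff_systemCoeff hh]
  rw [hc' hh, hc' (h := fun i => X i ^ r i) fun i => by simpa using (isHomogeneous_X ℂ i).pow (r i),
    hR.eval_X_pow, mul_one]

theorem IsResultant.eval_C_mul {R : MvPolynomial (CoeffIndex r) ℂ} (hR : IsResultant r R)
    {u : Fin n → ℂ} (hu : ∀ i, u i ≠ 0) {h : Fin n → MvPolynomial (Fin n) ℂ}
    (hh : ∀ i, (h i).IsHomogeneous (r i)) :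
    eval (systemCoeff r fun i => C (u i) * h i) R =
      eval (systemCoeff r fun i => C (u i) * X i ^ r i) R * eval (systemCoeff r h) R := by
  have ht : ∀ (u : Fin n → ℂ) (a : CoeffIndex r → ℂ),
      (fun c => eval a (C (u c.1) * X c)) = systemCoeff r fun i => C (u i) * ofCoeff a i := by
    intro u a
    funext c
    simp [systemCoeff, coeff_C_mul, coeff_ofCoeff]
  obtain ⟨c, hc⟩ := hR.exists_eval_eq_mul (s := fun c => C (u c.1)⁻¹ * X c)
    (t := fun c => C (u c.1) * X c)
    (fun a c => by simp [hu]) (fun a c => by simp [hu])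
    (fun a => by
      rw [ht, ofCoeff_systemCoeff fun i => by
        simpa using (isHomogeneous_C (Fin n) (u i)).mul (ofCoeff_isHomogeneous a i)]
      simp [HasZero, hu])
  have hc' : ∀ {h : Fin n → MvPolynomial (Fin n) ℂ}, (∀ i, (h i).IsHomogeneous (r i)) →
      eval (systemCoeff r fun i => C (u i) * h i) R = c * eval (systemCoeff r h) R := by
    intro h hh
    rw [← hc, ht, ofCoeff_systemCoeff hh]
  rw [hc' hh, hc' (h := fun i => X i ^ r i) fun i => by simpa using (isHomogeneous_X ℂ i).pow (r i),
    hR.eval_X_pow, mul_one]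

/-! ### A Macaulay determinant of prescribed degree in one form -/

section Macaulay

theorem exists_le_of_degree_eq {β : Fin n →₀ ℕ}
    (hβ : β.degree = ∑ j, (r j - 1) + 1) : ∃ j, r j ≤ β j := by
  by_contra! hlt
  rw [Finsupp.degree_eq_sum] at hβ
  have : ∑ j, β j ≤ ∑ j, (r j - 1) := Finset.sum_le_sum fun j _ => by have := hlt j; omega
  omega

/-- The exponents at `j ≠ i` range freely below `r j`; the degree then fixes the `i`-th one,
nonnegative by `hN`. -/
theorem card_filter_degree_eq (r : Fin n → ℕ) {N : ℕ} (hN : ∑ j, (r j - 1) ≤ N) (i : Fin n) :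
    (Finset.univ.filter fun β : {β : Fin n →₀ ℕ // β.degree = N} =>
      ∀ j, j ≠ i → β.1 j < r j).card = ∏ j ∈ Finset.univ.erase i, r j := by
  have hcard : (Fintype.piFinset fun j => Finset.range (if j = i then 1 else r j)).card =
      ∏ j ∈ Finset.univ.erase i, r j := by
    rw [Fintype.card_piFinset, ← Finset.mul_prod_erase _ _ (Finset.mem_univ i)]
    simp only [Finset.card_range, if_true, one_mul]
    exact Finset.prod_congr rfl fun j hj => if_neg (Finset.ne_of_mem_erase hj)
  have hdeg : ∀ β : Fin n →₀ ℕ, β.degree = β i + ∑ j ∈ Finset.univ.erase i, β j := fun β => by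
    rw [Finsupp.degree_eq_sum, Finset.add_sum_erase _ _ (Finset.mem_univ i)]
  rw [← hcard]
  refine Finset.card_bij (fun β _ j => if j = i then 0 else β.1 j) ?_ ?_ ?_
  · intro β hβ
    simp only [Finset.mem_filter, Finset.mem_univ, true_and] at hβ
    simp only [Fintype.mem_piFinset, Finset.mem_range]
    intro j
    split_ifs with hj
    · exact one_pos
    · exact hβ j hj
  · intro β _ γ _ h
    have hne : ∀ j, j ≠ i → β.1 j = γ.1 j := fun j hj => by simpa [hj] using congr_fun h j
    have hsum : ∑ j ∈ Finset.univ.erase i, β.1 j = ∑ j ∈ Finset.univ.erase i, γ.1 j :=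
      Finset.sum_congr rfl fun j hj => hne j (Finset.ne_of_mem_erase hj)
    have h1 := β.2
    have h2 := γ.2
    rw [hdeg] at h1 h2
    ext j
    rcases eq_or_ne j i with rfl | hj
    · omega
    · exact hne j hj
  · intro f hf
    simp only [Fintype.mem_piFinset, Finset.mem_range] at hf
    have hlt : ∀ j, j ≠ i → f j < r j := fun j hj => by simpa [hj] using hf j
    have hle : ∑ j ∈ Finset.univ.erase i, f j ≤ N := by
      refine le_trans ?_ hN
      rw [← Finset.add_sum_erase _ _ (Finset.mem_univ i)]
      refine le_trans (Finset.sum_le_sum fun j hj => ?_) (Nat.le_add_left _ _)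
      have := hlt j (Finset.ne_of_mem_erase hj)
      omega
    refine ⟨⟨Finsupp.equivFunOnFinite.symm
      (Function.update f i (N - ∑ j ∈ Finset.univ.erase i, f j)), ?_⟩, ?_, ?_⟩
    · rw [hdeg]
      simp only [Finsupp.equivFunOnFinite_symm_apply_apply, Function.update_self]
      rw [Finset.sum_congr rfl fun j hj =>
        Function.update_of_ne (Finset.ne_of_mem_erase hj) _ f]
      exact Nat.sub_add_cancel hle
    · simpa +contextual using hlt
    · funext j
      rcases eq_or_ne j i with rfl | hj
      · have := hf j
        simp only [if_true] at this ⊢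
        omega
      · simp [hj]

/-- A determinant of Macaulay type: it vanishes at all systems with a nontrivial zero, and has the
expected degree in the `i`-th form. -/
theorem exists_macaulay_eval (r : Fin n → ℕ) (i : Fin n) :
    ∃ D : MvPolynomial (CoeffIndex r) ℂ, (∀ a, HasZero (ofCoeff a) → eval a D = 0) ∧
      ∀ t : ℂ, eval (systemCoeff r fun j => C (if j = i then t else 1) * X j ^ r j) D =
        t ^ ∏ j ∈ Finset.univ.erase i, r j := by
  classical
  set N := ∑ j, (r j - 1) + 1 with hN
  have hrN : ∀ j, r j ≤ N := fun j => by
    have := Finset.single_le_sum (f := fun j => r j - 1) (fun _ _ => Nat.zero_le _)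
      (Finset.mem_univ j)
    omega
  -- The row of `β` uses a form whose pure power divides the monomial `β`. Taking the `i`-th form
  -- only when no other is available keeps the degree in it down to `∏_{j ≠ i} r j`.
  have hex : ∀ β : {β : Fin n →₀ ℕ // β.degree = N}, ∃ j, r j ≤ β.1 j ∧
      (j = i ↔ ∀ k, k ≠ i → β.1 k < r k) := by
    intro β
    by_cases h : ∀ k, k ≠ i → β.1 k < r k
    · obtain ⟨j, hj⟩ := exists_le_of_degree_eq β.2
      have hji : j = i := by
        by_contra hji
        have := h j hji
        omega
      exact ⟨j, hj, by simp [hji]; exact h⟩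
    · have h' := h
      push Not at h'
      obtain ⟨k, hk, hk'⟩ := h'
      exact ⟨k, hk', iff_of_false hk h⟩
  choose σ hσ hσi using hex
  let q (β : {β : Fin n →₀ ℕ // β.degree = N}) (j : Fin n) : MvPolynomial (Fin n) ℂ :=
    if j = σ β then monomial (β.1 - Finsupp.single j (r j)) 1 else 0
  have hsub : ∀ β, Finsupp.single (σ β) (r (σ β)) ≤ β.1 := fun β => by simpa using hσ β
  refine ⟨combDet r N q, fun a ha => eval_combDet_eq_zero (m := fun j => N - r j)
    (fun j => Nat.sub_add_cancel (hrN j)) (fun β j => ?_) ha, fun t => ?_⟩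
  · simp only [q]
    split_ifs with h
    · subst h
      refine isHomogeneous_monomial _ ?_
      have : (β.1 - Finsupp.single (σ β) (r (σ β))).degree +
          (Finsupp.single (σ β) (r (σ β))).degree = N := by
        rw [← map_add, tsub_add_cancel_of_le (hsub β), β.2]
      rw [Finsupp.degree_single] at this
      omega
    · exact isHomogeneous_zero _ _ _
  · rw [eval_combDet, ofCoeff_systemCoeff fun j => by
      simpa using (isHomogeneous_C (Fin n) _).mul ((isHomogeneous_X ℂ j).pow (r j))]
    have hdiag : (Matrix.of fun β γ : {β : Fin n →₀ ℕ // β.degree = N} => coeff γ.1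
        (∑ j, q β j * (C (if j = i then t else 1) * X j ^ r j))) =
        Matrix.diagonal fun β => if σ β = i then t else 1 := by
      ext β γ
      rw [Matrix.of_apply, Finset.sum_eq_single (σ β) (fun j _ hj => by simp [q, hj]) (by simp)]
      simp only [q, if_true]
      rw [mul_left_comm, X_pow_eq_monomial, monomial_mul, mul_one,
        tsub_add_cancel_of_le (hsub β), coeff_C_mul, coeff_monomial, Matrix.diagonal_apply]
      simp [Subtype.ext_iff]
    rw [hdiag, Matrix.det_diagonal, Finset.prod_ite, Finset.prod_const, Finset.prod_const_one,
      mul_one, ← card_filter_degree_eq r (Nat.le_succ _) i]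
    simp only [hσi]
    congr!

end Macaulay

/-! ### Degree of the resultant in one form: upper bound -/

section Degree

/-- The powers `X_j ^ r j`, with the `i`-th form multiplied by the variable of `ℂ[X]`. -/
def scaledPow (r : Fin n → ℕ) (i j : Fin n) : MvPolynomial (Fin n) (Polynomial ℂ) :=
  C (if j = i then Polynomial.X else 1) * X j ^ r j

/-- `R` divides the Macaulay determinant, which is a power of `t` along the scaled pure powers. So
`R` is a constant times `t ^ k` there, and `t = 1` shows that the constant is 1. -/
theorem IsResultant.exists_eval_scale {R : MvPolynomial (CoeffIndex r) ℂ} (hR : IsResultant r R)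
    (i : Fin n) :
    ∃ k ≤ ∏ j ∈ Finset.univ.erase i, r j, ∀ (t : ℂ), t ≠ 0 →
      ∀ h : Fin n → MvPolynomial (Fin n) ℂ, (∀ j, (h j).IsHomogeneous (r j)) →
      eval (systemCoeff r fun j => C (if j = i then t else 1) * h j) R =
        t ^ k * eval (systemCoeff r h) R := by
  obtain ⟨D, hD, hDt⟩ := exists_macaulay_eval r i
  obtain ⟨E, rfl⟩ : R ∣ D := dvd_of_forall_eval_eq_zero hR.irreducible fun a ha =>
    hD a ((hR.eval_eq_zero_iff_hasZero a).1 ha)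
  have hmap : ∀ (t : ℂ) (Q : MvPolynomial (CoeffIndex r) ℂ),
      (curvePoly Q (scaledPow r i)).eval t =
        eval (systemCoeff r fun j => C (if j = i then t else 1) * X j ^ r j) Q := by
    intro t Q
    rw [eval_curvePoly]
    congr 3
    funext j
    simp only [scaledPow, map_mul, map_pow, map_C, map_X]
    split_ifs <;> simp
  have hmul : curvePoly R (scaledPow r i) * curvePoly E (scaledPow r i) =
      Polynomial.X ^ ∏ j ∈ Finset.univ.erase i, r j := by
    refine Polynomial.funext fun t => ?_
    rw [Polynomial.eval_mul, hmap, hmap, ← map_mul, hDt]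
    simp
  obtain ⟨k, hk, hass⟩ := (dvd_prime_pow Polynomial.prime_X _).1 (Dvd.intro _ hmul)
  refine ⟨k, hk, fun t ht h hh => ?_⟩
  rw [hR.eval_C_mul (fun j => by split_ifs <;> simp [ht]) hh, ← hmap]
  obtain ⟨u, hu⟩ := hass.symm
  obtain ⟨c, -, hc⟩ := Polynomial.isUnit_iff.1 u.isUnit
  have h1 := hmap 1 R
  simp only [ite_self, C_1, one_mul, hR.eval_X_pow] at h1
  rw [← hu, ← hc] at h1 ⊢
  simp only [Polynomial.eval_mul, Polynomial.eval_pow, Polynomial.eval_X, one_pow, one_mul,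
    Polynomial.eval_C] at h1 ⊢
  rw [h1, mul_one]

end Degree

end

/-! ### Degree of the resultant: lower bound, and linear changes of variables -/

noncomputable section

variable {n : ℕ} {r : Fin n → ℕ}

/-- Separating the root points by a linear form makes the roots in the pencil below distinct. -/
theorem exists_dual_injOn (Z : Finset (Fin n → ℂ)) :
    ∃ f : Module.Dual ℂ (Fin n → ℂ), Set.InjOn f Z := by
  obtain ⟨f, hf⟩ := Module.exists_dual_forall_apply_ne_zero (K := ℂ)
    (fun p : {p : Z × Z // p.1 ≠ p.2} => (p.1.1 : Fin n → ℂ) - p.1.2)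
    (fun p => sub_ne_zero.2 fun h => p.2 (Subtype.ext h))
  refine ⟨f, fun x hx y hy hxy => ?_⟩
  by_contra hne
  exact hf ⟨(⟨x, hx⟩, ⟨y, hy⟩), fun h => hne (congrArg Subtype.val h)⟩ (by simp [hxy])

/-- The linear form with given values. -/
def dualForm (f : Module.Dual ℂ (Fin n → ℂ)) : MvPolynomial (Fin n) ℂ :=
  ∑ k, C (f (Pi.single k 1)) * X k

theorem eval_dualForm (f : Module.Dual ℂ (Fin n → ℂ)) (x : Fin n → ℂ) :
    eval x (dualForm f) = f x := by
  classical
  conv_rhs => rw [pi_eq_sum_univ' x]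
  simp only [dualForm, map_sum, map_mul, eval_C, eval_X, map_smul, smul_eq_mul, mul_comm]

theorem dualForm_isHomogeneous (f : Module.Dual ℂ (Fin n → ℂ)) : (dualForm f).IsHomogeneous 1 :=
  IsHomogeneous.sum _ _ _ fun k _ => by
    simpa using (isHomogeneous_C (Fin n) _).mul (isHomogeneous_X ℂ k)

/-- The points with `i`-th coordinate one and `j`-th coordinate an `r j`-th root of unity. -/
def rootPoints (r : Fin n → ℕ) (i : Fin n) : Finset (Fin n → ℂ) :=
  Fintype.piFinset fun j => Polynomial.nthRootsFinset (if j = i then 1 else r j) (1 : ℂ)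

theorem mem_rootPoints (hr : ∀ i, 0 < r i) {i : Fin n} {z : Fin n → ℂ} :
    z ∈ rootPoints r i ↔ z i = 1 ∧ ∀ j, j ≠ i → z j ^ r j = 1 := by
  simp only [rootPoints, Fintype.mem_piFinset]
  constructor
  · intro h
    refine ⟨by simpa using h i, fun j hj => ?_⟩
    have := h j
    rwa [if_neg hj, Polynomial.mem_nthRootsFinset (hr j)] at this
  · rintro ⟨h1, h2⟩ j
    split_ifs with hj
    · simp [hj, h1]
    · exact (Polynomial.mem_nthRootsFinset (hr j) _).2 (h2 j hj)

theorem card_rootPoints (hr : ∀ i, 0 < r i) (i : Fin n) :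
    (rootPoints r i).card = ∏ j ∈ Finset.univ.erase i, r j := by
  have hcard : ∀ m, 0 < m → (Polynomial.nthRootsFinset m (1 : ℂ)).card = m := fun m hm =>
    (Complex.isPrimitiveRoot_exp m hm.ne').card_nthRootsFinset
  rw [rootPoints, Fintype.card_piFinset, ← Finset.mul_prod_erase _ _ (Finset.mem_univ i),
    if_pos rfl, hcard 1 one_pos, one_mul]
  exact Finset.prod_congr rfl fun j hj => by
    rw [if_neg (Finset.ne_of_mem_erase hj), hcard _ (hr j)]

/-- The system `X_j ^ r j - X_i ^ r j` for `j ≠ i`, and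
`s * X_i ^ r i + u * X_i ^ (r i - 1) * f` as `i`-th form. -/
def pencil {A : Type*} [CommRing A] (r : Fin n → ℕ) (i : Fin n) (f : MvPolynomial (Fin n) A)
    (s u : A) (j : Fin n) : MvPolynomial (Fin n) A :=
  if j = i then C s * X i ^ r i + C u * (X i ^ (r i - 1) * f) else X j ^ r j - X i ^ r j

theorem pencil_isHomogeneous (hr : ∀ i, 0 < r i) (i : Fin n) {f : MvPolynomial (Fin n) ℂ}
    (hf : f.IsHomogeneous 1) (s u : ℂ) (j : Fin n) : (pencil r i f s u j).IsHomogeneous (r j) := by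
  have hX : ∀ k m, (X k ^ m : MvPolynomial (Fin n) ℂ).IsHomogeneous m := fun k m => by
    simpa using (isHomogeneous_X ℂ k).pow m
  rw [pencil]
  split_ifs with h
  · subst h
    refine IsHomogeneous.add ?_ ?_
    · simpa using (isHomogeneous_C (Fin n) s).mul (hX j (r j))
    · have := (isHomogeneous_C (Fin n) u).mul ((hX j (r j - 1)).mul hf)
      rwa [zero_add, Nat.sub_add_cancel (hr j)] at this
  · exact (hX j (r j)).sub (hX i (r j))

theorem map_pencil {A B : Type*} [CommRing A] [CommRing B] (φ : A →+* B) (i : Fin n)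
    (f : MvPolynomial (Fin n) A) (s u : A) (j : Fin n) :
    map φ (pencil r i f s u j) = pencil r i (map φ f) (φ s) (φ u) j := by
  simp only [pencil]
  split_ifs <;> simp

/-- The equations for `j ≠ i` force `x i ≠ 0`; after scaling to `x i = 1` the zero is a root point
`z`, where the `i`-th form takes the value `s + f z`. -/
theorem hasZero_pencil_iff (hr : ∀ i, 0 < r i) (i : Fin n) (f : Module.Dual ℂ (Fin n → ℂ))
    (s : ℂ) : HasZero (pencil r i (dualForm f) s 1) ↔ ∃ z ∈ rootPoints r i, s = -f z := by
  constructor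
  · rintro ⟨x, hx, hz⟩
    have hj : ∀ j, j ≠ i → x j ^ r j = x i ^ r j := fun j hj => by
      have := hz j
      simpa [pencil, hj, sub_eq_zero] using this
    have hxi : x i ≠ 0 := by
      intro h0
      refine hx (funext fun j => ?_)
      rcases eq_or_ne j i with rfl | hji
      · exact h0
      · have := hj j hji
        rw [h0, zero_pow (hr j).ne'] at this
        exact eq_zero_of_pow_eq_zero this
    refine ⟨(x i)⁻¹ • x, (mem_rootPoints hr).2 ⟨by simp [hxi], fun j hji => ?_⟩, ?_⟩
    · rw [Pi.smul_apply, smul_eq_mul, mul_pow, hj j hji, ← mul_pow, inv_mul_cancel₀ hxi, one_pow]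
    · have := hz i
      simp only [pencil, if_true, map_add, map_mul, eval_C, map_pow, eval_X, eval_dualForm,
        one_mul] at this
      rw [map_smul, smul_eq_mul]
      have hp := pow_ne_zero (r i - 1) hxi
      obtain ⟨m, hm⟩ := Nat.exists_eq_succ_of_ne_zero (hr i).ne'
      rw [hm, Nat.succ_sub_one, pow_succ] at this
      rw [hm, Nat.succ_sub_one] at hp
      have h2 : x i ^ m * (s * x i + f x) = 0 := by linear_combination this
      have h3 := (mul_eq_zero.1 h2).resolve_left hp
      field_simp
      linear_combination h3
  · rintro ⟨z, hz, rfl⟩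
    obtain ⟨h1, h2⟩ := (mem_rootPoints hr).1 hz
    refine ⟨z, fun h => by simp [h] at h1, fun j => ?_⟩
    rw [pencil]
    split_ifs with hj
    · simp [eval_dualForm, h1]
    · simp [h1, h2 j hj]

/-- The resultant is homogeneous in the `i`-th form, of degree the product of the other
degrees. -/
theorem IsResultant.eval_scale {R : MvPolynomial (CoeffIndex r) ℂ} (hR : IsResultant r R)
    (hr : ∀ i, 0 < r i) (i : Fin n) {t : ℂ} (ht : t ≠ 0) {h : Fin n → MvPolynomial (Fin n) ℂ}
    (hh : ∀ j, (h j).IsHomogeneous (r j)) :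
    eval (systemCoeff r fun j => C (if j = i then t else 1) * h j) R =
      t ^ (∏ j ∈ Finset.univ.erase i, r j) * eval (systemCoeff r h) R := by
  obtain ⟨k, hk, hscale⟩ := hR.exists_eval_scale i
  suffices hle : ∏ j ∈ Finset.univ.erase i, r j ≤ k by
    rw [le_antisymm hle hk]
    exact hscale t ht h hh
  obtain ⟨f, hf⟩ := exists_dual_injOn (rootPoints r i)
  have hhom := pencil_isHomogeneous hr i (dualForm_isHomogeneous f)
  have hC : ∀ s, map (Polynomial.evalRingHom s) (map Polynomial.C (dualForm f)) = dualForm f := by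
    intro s
    have : (Polynomial.evalRingHom s).comp Polynomial.C = RingHom.id ℂ := by ext; simp
    rw [map_map, this, map_id]
  -- `P` and `Q` follow the pencil in its two affine charts. Scaling the `i`-th form gives `P(s) = s
  -- ^ k * Q(1 / s)`, so `P` has degree at most `k`, while it has one root `-f z` for each root
  -- point.
  set P := curvePoly R (pencil r i (map Polynomial.C (dualForm f)) Polynomial.X 1) with hP
  set Q := curvePoly R (pencil r i (map Polynomial.C (dualForm f)) 1 Polynomial.X) with hQ
  have hPs : ∀ s, P.eval s = eval (systemCoeff r (pencil r i (dualForm f) s 1)) R := by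
    intro s
    rw [hP, eval_curvePoly]
    simp only [map_pencil, hC]
    simp
  have hQs : ∀ s, Q.eval s = eval (systemCoeff r (pencil r i (dualForm f) 1 s)) R := by
    intro s
    rw [hQ, eval_curvePoly]
    simp only [map_pencil, hC]
    simp
  have hPQ : ∀ s, s ≠ 0 → P.eval s = s ^ k * Q.eval s⁻¹ := by
    intro s hs
    rw [hPs, hQs, ← hscale s hs _ (hhom _ _)]
    congr 2
    refine congrArg _ (funext fun j => ?_)
    simp only [pencil]
    split_ifs
    · rw [mul_add, ← mul_assoc (C s) (C 1), ← C_mul, mul_one, ← mul_assoc (C s) (C s⁻¹), ← C_mul,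
        mul_inv_cancel₀ hs]
    · simp
  have hdeg : P.natDegree ≤ k := by
    have hmul : Polynomial.X ^ Q.natDegree * P = Polynomial.X ^ k * Q.reverse := by
      refine Polynomial.eq_of_infinite_eval_eq _ _ (Set.Infinite.mono (s := {0}ᶜ) ?_
        (Set.finite_singleton (0 : ℂ)).infinite_compl)
      intro s hs
      have hs : s ≠ 0 := hs
      let _ : Invertible s⁻¹ := invertibleOfNonzero (inv_ne_zero hs)
      have := Polynomial.eval₂_reverse_mul_pow (RingHom.id ℂ) s⁻¹ Q
      rw [invOf_eq_inv, inv_inv] at this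
      simp only [Polynomial.eval₂_id] at this
      simp only [Set.mem_ofPred_eq, Polynomial.eval_mul, Polynomial.eval_pow, Polynomial.eval_X]
      rw [hPQ s hs, ← this, inv_pow]
      field_simp
    by_cases hP0 : P = 0
    · simp [hP0]
    have h1 := congrArg Polynomial.natDegree hmul
    rw [Polynomial.natDegree_X_pow_mul _ hP0] at h1
    have h2 := Polynomial.natDegree_mul_le (p := Polynomial.X ^ k) (q := Q.reverse)
    rw [Polynomial.natDegree_X_pow] at h2
    have h3 := Polynomial.reverse_natDegree_le Q
    omega
  have hroot : ∀ s, P.eval s = 0 ↔ ∃ z ∈ rootPoints r i, s = -f z := by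
    intro s
    rw [hPs, hR.eval_eq_zero_iff _ (hhom _ _), ← hasZero_pencil_iff hr]
    rfl
  have himage : ∀ s, P.eval s = 0 ↔ s ∈ (rootPoints r i).image fun z => -f z := by
    intro s
    rw [hroot, Finset.mem_image]
    exact exists_congr fun z => and_congr_right fun _ => eq_comm
  have hP0 : P ≠ 0 := by
    intro h0
    obtain ⟨s, hs⟩ := Infinite.exists_notMem_finset ((rootPoints r i).image fun z => -f z)
    exact hs ((himage s).1 (by simp [h0]))
  rw [← card_rootPoints hr i, ← Finset.card_image_of_injOn (f := fun z => -f z)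
    (fun x hx y hy hxy => hf hx hy (neg_injective hxy))]
  refine le_trans (Polynomial.card_le_degree_of_subset_roots fun s hs => ?_) hdeg
  rw [Polynomial.mem_roots hP0]
  exact (himage s).2 hs

theorem IsResultant.eval_C_mul_eq {R : MvPolynomial (CoeffIndex r) ℂ} (hR : IsResultant r R)
    (hr : ∀ i, 0 < r i) {u : Fin n → ℂ} (hu : ∀ i, u i ≠ 0) {h : Fin n → MvPolynomial (Fin n) ℂ}
    (hh : ∀ j, (h j).IsHomogeneous (r j)) :
    eval (systemCoeff r fun j => C (u j) * h j) R =
      (∏ i, u i ^ ∏ j ∈ Finset.univ.erase i, r j) * eval (systemCoeff r h) R := by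
  classical
  have key : ∀ s : Finset (Fin n),
      eval (systemCoeff r fun j => C (if j ∈ s then u j else 1) * h j) R =
        (∏ i ∈ s, u i ^ ∏ j ∈ Finset.univ.erase i, r j) * eval (systemCoeff r h) R := by
    intro s
    induction s using Finset.induction_on with
    | empty => simp
    | insert i s hi ih =>
      rw [Finset.prod_insert hi, mul_assoc, ← ih, ← hR.eval_scale hr i (hu i) fun j => by
        simpa using (isHomogeneous_C (Fin n) _).mul (hh j)]
      congr 2
      refine congrArg _ (funext fun j => ?_)
      rw [← mul_assoc, ← C_mul]
      congr 2
      rcases eq_or_ne j i with rfl | hj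
      · simp [hi]
      · simp [hj]
  simpa using key Finset.univ

/-- The behaviour of the resultant under a linear change of variables. -/
theorem IsResultant.eval_linSubst_eq {R : MvPolynomial (CoeffIndex r) ℂ} (hR : IsResultant r R)
    (hr : ∀ i, 0 < r i) (G : Matrix (Fin n) (Fin n) ℂ) (hG : G.det ≠ 0) :
    ∀ h : Fin n → MvPolynomial (Fin n) ℂ, (∀ i, (h i).IsHomogeneous (r i)) →
      eval (systemCoeff r fun i => linSubst G (h i)) R =
        G.det ^ (∏ i, r i) * eval (systemCoeff r h) R := by
  have hXpow : ∀ i, (X i ^ r i : MvPolynomial (Fin n) ℂ).IsHomogeneous (r i) := fun i => by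
    simpa using (isHomogeneous_X ℂ i).pow (r i)
  refine Matrix.diagonal_transvection_induction_of_det_ne_zero
    (fun G => ∀ h : Fin n → MvPolynomial (Fin n) ℂ, (∀ i, (h i).IsHomogeneous (r i)) →
      eval (systemCoeff r fun i => linSubst G (h i)) R =
        G.det ^ (∏ i, r i) * eval (systemCoeff r h) R) G hG ?_ ?_ ?_
  · intro u hu h hh
    have hu' : ∀ i, u i ≠ 0 := by
      rw [Matrix.det_diagonal] at hu
      exact fun i => Finset.prod_ne_zero_iff.1 hu i (Finset.mem_univ i)
    rw [hR.eval_linSubst hu hh]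
    congr 1
    -- The `i`-th pure power is scaled by `u i ^ r i`, so `u i` contributes with exponent `r i *
    -- ∏_{j ≠ i} r j`.
    have : (fun i => linSubst (Matrix.diagonal u) (X i ^ r i)) =
        fun i => C (u i ^ r i) * X i ^ r i := by
      funext i
      simp [linSubst, Matrix.diagonal_apply, apply_ite C, ite_mul, mul_pow]
    rw [this, hR.eval_C_mul_eq hr (fun i => pow_ne_zero _ (hu' i)) hXpow, hR.eval_X_pow, mul_one,
      Matrix.det_diagonal, ← Finset.prod_pow]
    refine Finset.prod_congr rfl fun i _ => ?_
    rw [← pow_mul, Finset.mul_prod_erase _ _ (Finset.mem_univ i)]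
  · intro T h hh
    rw [Matrix.TransvectionStruct.det, one_pow, one_mul,
      hR.eval_linSubst (by simp) hh]
    convert one_mul _
    obtain ⟨a, b, hab, c⟩ := T
    simp only [Matrix.TransvectionStruct.toMatrix_mk]
    -- The transvected pure powers never have a nontrivial zero, so `P` has no roots. It is thus
    -- constant, equal to its value 1 at `t = 0`.
    set P := curvePoly R fun i =>
      linSubst (Matrix.transvection a b Polynomial.X) (X i ^ r i) with hP
    have hPt : ∀ t, P.eval t =
        eval (systemCoeff r fun i => linSubst (Matrix.transvection a b t) (X i ^ r i)) R := by
      intro t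
      rw [hP, eval_curvePoly]
      simp only [map_linSubst, transvection_X_map, map_pow, map_X]
    have hne : ∀ t, P.eval t ≠ 0 := by
      intro t h0
      rw [hPt, hR.eval_eq_zero_iff _ fun i => linSubst_isHomogeneous _ (hXpow i)] at h0
      exact not_hasZero_X_pow r (HasZero.of_linSubst
        (by simp [Matrix.det_transvection_of_ne _ _ hab]) h0)
    have hdeg : P.degree = 0 := by
      by_contra hd
      obtain ⟨t, ht⟩ := IsAlgClosed.exists_root P hd
      exact hne t ht
    rw [← hPt, Polynomial.eq_C_of_degree_eq_zero hdeg, Polynomial.eval_C,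
      Polynomial.coeff_zero_eq_eval_zero, hPt]
    simp [linSubst_one, hR.eval_X_pow]
  · intro A B _ _ ihA ihB h hh
    have hl := ihB (fun i => linSubst A (h i)) fun i => linSubst_isHomogeneous A (hh i)
    simp only [linSubst_linSubst] at hl
    rw [hl, ihA h hh, Matrix.det_mul, mul_pow]
    ring

end

/-! ### Tensors and the E-determinant -/

noncomputable section

instance uniqueFinTwoSubOne : Unique (Fin (2 - 1)) := inferInstanceAs (Unique (Fin 1))

theorem Tensor.form_isHomogeneous {n m : ℕ} (T : Tensor n m) (i : Fin n) :
    (T.form i).IsHomogeneous (m - 1) :=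
  IsHomogeneous.sum _ _ _ fun j _ => by
    have := (isHomogeneous_C (Fin n) (T i j)).mul
      (IsHomogeneous.prod Finset.univ (fun k => X (j k)) (fun _ => 1) fun k _ =>
        isHomogeneous_X ℂ (j k))
    simpa using this

theorem Tensor.form_comp {n p : ℕ} (U : Tensor n p) (G : Tensor n 2) (i : Fin n) :
    (U.comp G).form i = linSubst G.toMatrix (U.form i) := by
  classical
  have hlin : linSubst G.toMatrix (U.form i) =
      ∑ s : Fin (p - 1) → Fin n, C (U i s) *
        ∑ j : Fin (p - 1) → Fin n, ∏ k, (C (G (s k) fun _ => j k) * X (j k)) := by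
    simp only [Tensor.form, linSubst, map_sum, map_mul, map_prod, aeval_X, algHom_C,
      algebraMap_eq, Tensor.toMatrix, Matrix.of_apply]
    refine Finset.sum_congr rfl fun s _ => ?_
    rw [Finset.prod_univ_sum, Fintype.piFinset_univ]
  -- For `q = 2` the blocks have length one, so block positions and index positions correspond.
  let e : Fin (p - 1) ≃ Fin ((p - 1) * (2 - 1)) :=
    (Equiv.prodUnique (Fin (p - 1)) (Fin (2 - 1))).symm.trans finProdFinEquiv
  have he : ∀ (k : Fin (p - 1)) (l : Fin (2 - 1)), finProdFinEquiv (k, l) = e k := fun k l => by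
    rw [Subsingleton.elim l default]
    rfl
  rw [hlin]
  simp only [Tensor.form, Tensor.comp, he, map_sum, map_mul, map_prod, Finset.sum_mul,
    Finset.mul_sum]
  rw [Finset.sum_comm]
  refine Finset.sum_congr rfl fun s _ => ?_
  refine Fintype.sum_equiv (e.symm.arrowCongr (Equiv.refl (Fin n))) _ _ fun j => ?_
  rw [Finset.prod_mul_distrib, mul_assoc]
  congr 2
  exact (Fintype.prod_equiv e _ _ fun k => rfl).symm

theorem edet_eq_eval {n m m' : ℕ} (T : Tensor n m) (hm : m - 1 = m') :
    Edet T = eval (systemCoeff (fun _ => m') T.form) (resultantPoly fun _ => m') := by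
  subst hm
  rfl

theorem edet_comp {n p : ℕ} (hn : 2 ≤ n) (hp : 2 ≤ p) (U : Tensor n p) (G : Tensor n 2) :
    Edet (U.comp G) = Edet U * G.toMatrix.det ^ ((p - 1) ^ n) := by
  have hr : ∀ _ : Fin n, 0 < p - 1 := fun _ => by omega
  have hR := isResultant_resultantPoly hr ⟨0, by omega⟩
  rw [edet_eq_eval (U.comp G) (m' := p - 1) (by simp), edet_eq_eval U rfl,
    funext (Tensor.form_comp U G)]
  by_cases hG : G.toMatrix.det = 0
  · obtain ⟨x, hx, hGx⟩ := Matrix.exists_mulVec_eq_zero_iff.2 hG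
    rw [hG, zero_pow (pow_ne_zero _ (hr ⟨0, by omega⟩).ne'), mul_zero,
      hR.eval_eq_zero_iff _ fun i => linSubst_isHomogeneous _ (U.form_isHomogeneous i)]
    refine ⟨x, hx, fun i => ?_⟩
    rw [eval_linSubst, hGx, eval_zero, constantCoeff_eq,
      (U.form_isHomogeneous i).coeff_eq_zero (by simpa using (hr i).ne)]
  · rw [hR.eval_linSubst_eq hr _ hG _ U.form_isHomogeneous, mul_comm]
    simp

/-- The forms of the identity tensor `I` are the variables, so `I.comp G` has the forms of `G`, and
`edet_comp` applies with `p = 2`. -/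
theorem edet_eq_det {n : ℕ} (hn : 2 ≤ n) (G : Tensor n 2) : Edet G = G.toMatrix.det := by
  let I : Tensor n 2 := fun i j => if j 0 = i then 1 else 0
  have hI : I.form = fun i => X i ^ 1 := by
    funext i
    rw [Tensor.form, Fintype.sum_eq_single fun _ => i]
    · simp [I]
    · intro j hj
      have : j 0 ≠ i := fun h => hj (funext fun k => by rw [Subsingleton.elim k 0, h])
      simp [I, this]
  have hG : (I.comp G).form = G.form := by
    funext i
    rw [Tensor.form_comp, hI]
    simp only [pow_one, linSubst, aeval_X, Tensor.form, Tensor.toMatrix, Matrix.of_apply]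
    refine Fintype.sum_equiv (Equiv.funUnique (Fin (2 - 1)) (Fin n)).symm _ _ fun k => ?_
    simp
    rfl
  have hR := isResultant_resultantPoly (r := fun _ : Fin n => 2 - 1) (fun _ => by simp)
    ⟨0, by omega⟩
  have h1 : Edet I = 1 := by
    rw [edet_eq_eval I rfl, hI]
    exact hR.eval_X_pow
  have h2 : Edet (I.comp G) = Edet G := by
    rw [edet_eq_eval (I.comp G) rfl, edet_eq_eval G rfl, hG]
  rw [← h2, edet_comp hn le_rfl, h1]
  simp

end

theorem proposition4p4 (n p : ℕ) (hn : 2 ≤ n) (hp : 2 ≤ p) :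
    (∃! R, IsResultant (fun _ : Fin n => p - 1) R) ∧
    ∀ (U : Tensor n p) (G : Tensor n 2),
      Edet (U.comp G) = Edet U ^ ((2 - 1) ^ (n - 1)) * Edet G ^ ((p - 1) ^ n) ∧
      Edet (U.comp G) = Edet U * G.toMatrix.det ^ ((p - 1) ^ n) := by
  refine ⟨?_, fun U G => ⟨?_, edet_comp hn hp U G⟩⟩
  · obtain ⟨R, hR⟩ := exists_isResultant (r := fun _ : Fin n => p - 1) (fun _ => by omega)
      ⟨0, by omega⟩
    exact ⟨R, hR, fun S hS => hS.unique hR⟩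
  · rw [edet_comp hn hp, edet_eq_det hn]
    simp
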